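/- **Setting.** An instance of online bipartite matching is a finite bipartite graph $G=(S\cup R,E)$ whose servers $S$ are given offline and whose requests $R$ arrive one by one in a fixed order, each revealing its neighbourhood $N(r)\subseteq S$ on arrival. The graph is $(k,d)$-bounded if every server has degree at least $k$ and every request has degree at most $d$. For an integer $d\ge 2$ let $f^*_d:\{0,1,2,\dots\}\to\mathbb R$ be given by $f^*_d(0)=1$ and $$f^*_d(l)=f^*_d(l-1)\cdot\min_{1\le m<d}\Bigl(1+\frac{m\,f^*_d(l-1)}{d-m}\Bigr)^{1/m}\qquad(l\ge 1).$$ The OCS-based algorithm with $f^*_d$ works as follows: when a request $r$ arrives, let $A$ be the set of its currently unmatched neighbours and, for $s\in A$, let $l_s$ be the number of neighbours of $s$ that arrived before $r$. If $A\ne\emptyset$, then $r$ is matched to a random server, $s\in A$ being chosen with probability $f^*_d(l_s)/\sum_{s'\in A}f^*_d(l_{s'})$; if $A=\emptyset$, then $r$ stays unmatched. The competitive ratio of the algorithm on $(k,d)$-bounded graphs is the infimum of $\mathbb E[\mathsf{ALG}]/\mathsf{OPT}$ over all $(k,d)$-bounded instances with $\mathsf{OPT}>0$, where $\mathsf{ALG}$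 is the size of the matching produced and $\mathsf{OPT}$ is the maximum size of a matching of $G$. **Theorem.** There is an integer $d_0$ such that for all integers $d\ge \max\{2,d_0\}$ and $k>d$, with $\alpha=k/d>1$, the competitive ratio of the OCS-based algorithm with $f^*_d$ on $(k,d)$-bounded graphs is at least $$1-\Bigl(\frac{1}{3e}\Bigr)^{\alpha}.$$ -/

import Mathlib

noncomputable section

/-- An instance of online bipartite matching: the offline servers are `Fin servers`, the online
requests are `Fin requests`, arriving in the order `0, 1, 2, …`, and `nbr r` is the set `N(r)` of
servers adjacent to the request `r`. -/
structure OnlineInstance where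
  servers : ℕ
  requests : ℕ
  nbr : Fin requests → Finset (Fin servers)

namespace OnlineInstance

/-- The graph is `(k, d)`-bounded: every server has degree at least `k`, every request has degree
at most `d`. -/
def IsBounded (I : OnlineInstance) (k d : ℕ) : Prop :=
  (∀ s : Fin I.servers, k ≤ (Finset.univ.filter fun r => s ∈ I.nbr r).card) ∧
    ∀ r : Fin I.requests, (I.nbr r).card ≤ d

/-- A set of server-request pairs is a matching of the graph: it consists of edges, and no two
of them share an endpoint. -/
def IsMatching (I : OnlineInstance) (M : Finset (Fin I.servers × Fin I.requests)) : Prop :=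
  (∀ e ∈ M, e.1 ∈ I.nbr e.2) ∧
    ∀ e ∈ M, ∀ e' ∈ M, (e.1 = e'.1 ∨ e.2 = e'.2) → e = e'

open Classical in
/-- `OPT`: the maximum size of a matching of the graph. -/
def opt (I : OnlineInstance) : ℕ :=
  (Finset.univ.filter fun M => I.IsMatching M).sup Finset.card

/-- The number of neighbours of the server `s` that have arrived before the request `r`. -/
def degBefore (I : OnlineInstance) (r : Fin I.requests) (s : Fin I.servers) : ℕ :=
  (Finset.univ.filter fun r' => r' < r ∧ s ∈ I.nbr r').card

/-- The neighbours of the request `r` that the current matching `M` leaves unmatched. -/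
def available (I : OnlineInstance) (r : Fin I.requests)
    (M : Finset (Fin I.servers × Fin I.requests)) : Finset (Fin I.servers) :=
  (I.nbr r).filter fun s => ∀ r', (s, r') ∉ M

end OnlineInstance

/-- The input sequences of the algorithm: non-decreasing, with `f 0 = 1`. -/
structure WeightSeq where
  f : ℕ → ℝ
  zero : f 0 = 1
  mono : Monotone f

theorem WeightSeq.pos (w : WeightSeq) (l : ℕ) : 0 < w.f l :=
  lt_of_lt_of_le one_pos (w.zero ▸ w.mono (Nat.zero_le l))

/-- The distribution on a non-empty finite set `A` that picks `s ∈ A` with probability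
`c s / ∑ s' ∈ A, c s'`, for positive weights `c`. -/
def weightedChoice {S : Type} [DecidableEq S] (A : Finset S) (hA : A.Nonempty) (c : S → ℝ)
    (hc : ∀ s, 0 < c s) : PMF S :=
  PMF.ofFinset (fun s => if s ∈ A then ENNReal.ofReal (c s / ∑ s' ∈ A, c s') else 0) A
    (by
      have hpos : 0 < ∑ s' ∈ A, c s' := Finset.sum_pos (fun s _ => hc s) hA
      rw [Finset.sum_congr rfl (fun s hs => if_pos hs),
        ← ENNReal.ofReal_sum_of_nonneg (fun s _ => (div_pos (hc s) hpos).le),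
        ← Finset.sum_div, div_self hpos.ne', ENNReal.ofReal_one])
    (fun s hs => if_neg hs)

namespace OnlineInstance

/-- One round of the OCS-based algorithm: if the arriving request `r` has an unmatched neighbour,
it is matched to a random unmatched neighbour `s`, chosen with probability proportional to
`f (degBefore r s)`; otherwise it stays unmatched. -/
def ocsStep (I : OnlineInstance) (w : WeightSeq) (r : Fin I.requests)
    (M : Finset (Fin I.servers × Fin I.requests)) :
    PMF (Finset (Fin I.servers × Fin I.requests)) :=
  if hA : (I.available r M).Nonempty then
    (weightedChoice (I.available r M) hA (fun s => w.f (I.degBefore r s))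
      (fun _ => w.pos _)).map fun s => insert (s, r) M
  else PMF.pure M

/-- The distribution of the matching held by the OCS-based algorithm after the first `j` requests
(after all requests, if there are fewer than `j`). -/
def ocsRun (I : OnlineInstance) (w : WeightSeq) :
    ℕ → PMF (Finset (Fin I.servers × Fin I.requests))
  | 0 => PMF.pure ∅
  | j + 1 =>
    if hj : j < I.requests then (I.ocsRun w j).bind (I.ocsStep w ⟨j, hj⟩) else I.ocsRun w j

/-- `𝔼[ALG]`: the expected size of the final matching of the OCS-based algorithm. -/
def ocsExpected (I : OnlineInstance) (w : WeightSeq) : ℝ :=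
  ∑ M : Finset (Fin I.servers × Fin I.requests),
    (I.ocsRun w I.requests M).toReal * (M.card : ℝ)

end OnlineInstance

/-- The competitive ratio of the OCS-based algorithm with sequence `w` on `(k, d)`-bounded graphs:
the infimum of `𝔼[ALG] / OPT` over all `(k, d)`-bounded instances (with `OPT > 0`, so that the
quotient makes sense). -/
def ocsCompetitiveRatio (w : WeightSeq) (k d : ℕ) : ℝ :=
  sInf {ρ : ℝ | ∃ I : OnlineInstance, I.IsBounded k d ∧ 0 < I.opt ∧
    ρ = I.ocsExpected w / (I.opt : ℝ)}

/-- The values of the optimal candidate function `f*_d` for `d ≥ 2`: `f*_d(0) = 1` and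
`f*_d(l+1) = f*_d(l) * min_{1 ≤ m < d} (1 + m f*_d(l) / (d - m)) ^ (1 / m)`. -/
def optimalCandidateFun (d : ℕ) (hd : 2 ≤ d) : ℕ → ℝ
  | 0 => 1
  | l + 1 => optimalCandidateFun d hd l *
      (Finset.Ico 1 d).inf' (Finset.nonempty_Ico.2 hd) fun m : ℕ =>
        (1 + (m : ℝ) * optimalCandidateFun d hd l / ((d : ℝ) - (m : ℝ))) ^ ((1 : ℝ) / (m : ℝ))

theorem optimalCandidateFun_factor (d : ℕ) (hd : 2 ≤ d) {x : ℝ} (hx : 0 ≤ x) :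
    1 ≤ (Finset.Ico 1 d).inf' (Finset.nonempty_Ico.2 hd) fun m : ℕ =>
        (1 + (m : ℝ) * x / ((d : ℝ) - (m : ℝ))) ^ ((1 : ℝ) / (m : ℝ)) := by
  rw [Finset.le_inf'_iff]
  intro m hm
  have hmd : (m : ℝ) < d := by exact_mod_cast (Finset.mem_Ico.1 hm).2
  have h : 0 ≤ (m : ℝ) * x / ((d : ℝ) - (m : ℝ)) :=
    div_nonneg (mul_nonneg (Nat.cast_nonneg m) hx) (sub_nonneg.2 hmd.le)
  exact Real.one_le_rpow (by linarith) (by positivity)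

theorem optimalCandidateFun_pos (d : ℕ) (hd : 2 ≤ d) (l : ℕ) : 0 < optimalCandidateFun d hd l := by
  induction l with
  | zero => simp [optimalCandidateFun]
  | succ l ih =>
    rw [optimalCandidateFun]
    exact mul_pos ih (lt_of_lt_of_le one_pos (optimalCandidateFun_factor d hd ih.le))

/-- The optimal candidate function `f*_d`, as an input sequence of the algorithm. -/
def optimalCandidate (d : ℕ) (hd : 2 ≤ d) : WeightSeq where
  f := optimalCandidateFun d hd
  zero := by rw [optimalCandidateFun]
  mono := monotone_nat_of_le_succ fun l => by
    rw [optimalCandidateFun]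
    have h := optimalCandidateFun_pos d hd l
    exact le_mul_of_one_le_right h.le (optimalCandidateFun_factor d hd h.le)

end

/-! The invariant is a product bound: at every time and for every set `T` of servers, the
probability that all of `T` is unmatched is at most `∏ s ∈ T, 1 / f(l_s)` with `f = f*_d`. Suppose
`r` arrives with `U = T ∩ N(r)` non-empty, and let `F` be the weight of `U` and `X` the weight of
the unmatched neighbours outside `T`. An unmatched `T` survives with probability `X / (F + X)`,
which is concave in `X`. The invariant for the sets `insert s T` bounds the mean of `X` on that
event, because each weight `f(l_s)` cancels its factor `1 / f(l_s)`. The resulting factor `D / (F +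
D)`, with `D = d - |U|`, is absorbed by the growth of `f` from `l_s` to `l_s + 1`: by AM-GM the
recursion allows exactly this much (`optimalCandidateFun_prod_le`, `ocsStep_expect_le`). Singletons
`T` give the ratio `1 - 1 / f(k)` (`le_ocsCompetitiveRatio`).

It remains to show `f(k) ≥ (3e)^(k/d)`. Once `f ≥ F`, each step multiplies `f` by at least `exp (c /
d)` for any rate `c` with `HasGrowth F c`. Up to the value `2` the rate `c = F` works, so `1 / f`
falls by about `1 / d` per step and `f` reaches `2` in about `d / 2` steps. Five further rates,
certified by tangents, bring `f` above `3e` within `d` steps; from there the rate exceeds `log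
(3e)`. -/

/-! ### Expectations over finite probability spaces. -/

/-- The expectation of a real function under a distribution on a finite type. -/
noncomputable def PMF.expect {α : Type*} [Fintype α] (p : PMF α) (g : α → ℝ) : ℝ :=
  ∑ a, (p a).toReal * g a

namespace PMF

variable {α β : Type*} [Fintype α] [Fintype β]

theorem expect_pure (a : α) (g : α → ℝ) : (PMF.pure a).expect g = g a := by
  classical
  rw [expect, Finset.sum_eq_single a]
  · simp
  · intro b _ hb
    simp [PMF.pure_apply, hb]
  · simp

theorem expect_bind (p : PMF α) (q : α → PMF β) (g : β → ℝ) :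
    (p.bind q).expect g = p.expect fun a => (q a).expect g := by
  simp only [expect, PMF.bind_apply, tsum_fintype]
  simp_rw [ENNReal.toReal_sum (fun a _ => ENNReal.mul_ne_top (p.apply_ne_top a)
    ((q a).apply_ne_top _)), ENNReal.toReal_mul, Finset.sum_mul, Finset.mul_sum]
  rw [Finset.sum_comm]
  simp only [mul_assoc]

theorem expect_map (p : PMF α) (h : α → β) (g : β → ℝ) :
    (p.map h).expect g = p.expect fun a => g (h a) := by
  rw [← PMF.bind_pure_comp, expect_bind]
  simp only [Function.comp_apply, expect_pure]

theorem expect_mono (p : PMF α) {g h : α → ℝ} (hgh : ∀ a, g a ≤ h a) :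
    p.expect g ≤ p.expect h :=
  Finset.sum_le_sum fun a _ => mul_le_mul_of_nonneg_left (hgh a) ENNReal.toReal_nonneg

theorem expect_add (p : PMF α) (g h : α → ℝ) :
    (p.expect fun a => g a + h a) = p.expect g + p.expect h := by
  simp only [expect, mul_add, Finset.sum_add_distrib]

theorem expect_const_mul (p : PMF α) (c : ℝ) (g : α → ℝ) :
    (p.expect fun a => c * g a) = c * p.expect g := by
  simp only [expect, Finset.mul_sum]
  exact Finset.sum_congr rfl fun a _ => by ring

theorem expect_sum {ι : Type*} (p : PMF α) (s : Finset ι) (g : ι → α → ℝ) :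
    (p.expect fun a => ∑ i ∈ s, g i a) = ∑ i ∈ s, p.expect (g i) := by
  simp only [expect, Finset.mul_sum]
  exact Finset.sum_comm

theorem expect_const (p : PMF α) (c : ℝ) : (p.expect fun _ => c) = c := by
  have h : ∑ a, p a = 1 := by rw [← tsum_fintype (L := .unconditional _)]; exact p.tsum_coe
  rw [expect, ← Finset.sum_mul, ← ENNReal.toReal_sum (fun a _ => p.apply_ne_top a), h]
  simp

end PMF

theorem weightedChoice_expect {S : Type} [Fintype S] [DecidableEq S] (A : Finset S)
    (hA : A.Nonempty) (c : S → ℝ) (hc : ∀ s, 0 < c s) (g : S → ℝ) :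
    (weightedChoice A hA c hc).expect g = (∑ s ∈ A, c s * g s) / ∑ s ∈ A, c s := by
  have hpos : 0 < ∑ s ∈ A, c s := Finset.sum_pos (fun s _ => hc s) hA
  rw [PMF.expect, Finset.sum_div, ← Finset.sum_subset (Finset.subset_univ A)]
  · refine Finset.sum_congr rfl fun s hs => ?_
    rw [weightedChoice, PMF.ofFinset_apply, if_pos hs,
      ENNReal.toReal_ofReal (div_pos (hc s) hpos).le]
    ring
  · intro s _ hs
    rw [weightedChoice, PMF.ofFinset_apply, if_neg hs]
    simp

/-! ### The two inequalities behind one round: concavity and AM-GM. -/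

/-- The concave function `x ↦ x / (F + x)` lies below its tangent at `D`. -/
theorem div_add_le_tangent {F x D : ℝ} (hF : 0 < F) (hx : 0 ≤ x) (hD : 0 ≤ D) :
    x / (F + x) ≤ D ^ 2 / (F + D) ^ 2 + F / (F + D) ^ 2 * x := by
  have h1 : 0 < F + x := by linarith
  have h2 : 0 < F + D := by linarith
  have : D ^ 2 / (F + D) ^ 2 + F / (F + D) ^ 2 * x - x / (F + x)
      = F * (x - D) ^ 2 / ((F + D) ^ 2 * (F + x)) := by
    field_simp
    ring
  have : 0 ≤ F * (x - D) ^ 2 / ((F + D) ^ 2 * (F + x)) := by positivity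
  linarith

theorem optimalCandidateFun_succ_le (d : ℕ) (hd : 2 ≤ d) (l : ℕ) {m : ℕ} (hm : 1 ≤ m)
    (hmd : m < d) :
    optimalCandidateFun d hd (l + 1) ≤ optimalCandidateFun d hd l *
      (1 + (m : ℝ) * optimalCandidateFun d hd l / ((d : ℝ) - (m : ℝ))) ^ ((1 : ℝ) / (m : ℝ)) := by
  rw [optimalCandidateFun]
  exact mul_le_mul_of_nonneg_left (Finset.inf'_le _ (Finset.mem_Ico.2 ⟨hm, hmd⟩))
    (optimalCandidateFun_pos d hd l).le

/-- The growth condition under which the product bound survives one round of the algorithm. -/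
theorem optimalCandidateFun_prod_le (d : ℕ) (hd : 2 ≤ d) {S : Type*} (U : Finset S)
    (hU : U.Nonempty) (hUd : U.card < d) (l : S → ℕ) :
    (∏ s ∈ U, optimalCandidateFun d hd (l s + 1)) * ((d : ℝ) - U.card) ≤
      (∏ s ∈ U, optimalCandidateFun d hd (l s)) *
        (∑ s ∈ U, optimalCandidateFun d hd (l s) + ((d : ℝ) - U.card)) := by
  set f := optimalCandidateFun d hd with hf
  have hfpos : ∀ n, 0 < f n := optimalCandidateFun_pos d hd
  have hm : 0 < (U.card : ℝ) := by exact_mod_cast hU.card_pos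
  have hD : 0 < (d : ℝ) - U.card := sub_pos.2 (by exact_mod_cast hUd)
  set m : ℝ := (U.card : ℝ) with hm'
  set D : ℝ := (d : ℝ) - m with hD'
  have hbase : ∀ s, 0 ≤ 1 + m * f (l s) / D := fun s => by
    have := hfpos (l s); positivity
  have hle : ∏ s ∈ U, f (l s + 1) ≤
      (∏ s ∈ U, f (l s)) * ∏ s ∈ U, (1 + m * f (l s) / D) ^ ((1 : ℝ) / m) := by
    rw [← Finset.prod_mul_distrib]
    exact Finset.prod_le_prod (fun s _ => (hfpos _).le) fun s _ =>
      optimalCandidateFun_succ_le d hd (l s) hU.card_pos hUd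
  -- Only the term `m = |U|` of the minimum is used: its exponent `1 / m` turns the product into a
  -- geometric mean over `U`.
  have hamgm : ∏ s ∈ U, (1 + m * f (l s) / D) ^ ((1 : ℝ) / m) ≤
      1 + (∑ s ∈ U, f (l s)) / D := by
    have h := Real.geom_mean_le_arith_mean_weighted U (fun _ => (1 : ℝ) / m)
      (fun s => 1 + m * f (l s) / D) (fun _ _ => by positivity)
      (by rw [Finset.sum_const, nsmul_eq_mul]; exact mul_one_div_cancel hm.ne')
      (fun s _ => hbase s)
    refine h.trans_eq ?_
    have : ∀ s ∈ U, 1 / m * (1 + m * f (l s) / D) = 1 / m + f (l s) / D := fun s _ => by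
      field_simp
    rw [Finset.sum_congr rfl this, Finset.sum_add_distrib, Finset.sum_const, nsmul_eq_mul,
      Finset.sum_div]
    congr 1
    exact mul_one_div_cancel hm.ne'
  have hP : 0 ≤ ∏ s ∈ U, f (l s) := Finset.prod_nonneg fun s _ => (hfpos _).le
  calc (∏ s ∈ U, f (l s + 1)) * D
      ≤ ((∏ s ∈ U, f (l s)) * (1 + (∑ s ∈ U, f (l s)) / D)) * D :=
        mul_le_mul_of_nonneg_right (hle.trans (mul_le_mul_of_nonneg_left hamgm hP)) hD.le
    _ = _ := by field_simp; ring

/-! ### The product bound on the probability that a set of servers is unmatched. -/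

namespace OnlineInstance

variable (I : OnlineInstance)

/-- The indicator of the event that the matching `M` leaves all servers of `T` unmatched. -/
def unmatchedInd (T : Finset (Fin I.servers)) (M : Finset (Fin I.servers × Fin I.requests)) : ℝ :=
  if ∀ s ∈ T, ∀ r, (s, r) ∉ M then 1 else 0

/-- The number of neighbours of `s` among the first `j` requests. -/
def degUpTo (j : ℕ) (s : Fin I.servers) : ℕ :=
  (Finset.univ.filter fun r : Fin I.requests => r.val < j ∧ s ∈ I.nbr r).card

theorem degUpTo_eq_degBefore (r : Fin I.requests) (s : Fin I.servers) :
    I.degUpTo r s = I.degBefore r s := rfl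

theorem degUpTo_succ (r : Fin I.requests) (s : Fin I.servers) :
    I.degUpTo (r + 1) s = if s ∈ I.nbr r then I.degUpTo r s + 1 else I.degUpTo r s := by
  unfold degUpTo
  split_ifs with h
  · rw [← Finset.card_insert_of_notMem (a := r) (by simp)]
    congr 1
    ext r'
    simp only [Finset.mem_filter, Finset.mem_univ, true_and, Finset.mem_insert,
      Nat.lt_succ_iff_lt_or_eq, Fin.ext_iff]
    constructor
    · rintro ⟨h1 | h1, h2⟩
      · exact Or.inr ⟨h1, h2⟩
      · exact Or.inl h1
    · rintro (h1 | ⟨h1, h2⟩)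
      · exact ⟨Or.inr h1, by rwa [Fin.ext h1]⟩
      · exact ⟨Or.inl h1, h2⟩
  · congr 1
    ext r'
    simp only [Finset.mem_filter, Finset.mem_univ, true_and, Nat.lt_succ_iff_lt_or_eq]
    constructor
    · rintro ⟨h1 | h1, h2⟩
      · exact ⟨h1, h2⟩
      · exact absurd (by rwa [← Fin.ext h1]) h
    · exact fun h1 => ⟨Or.inl h1.1, h1.2⟩

theorem unmatchedInd_nonneg (T M) : 0 ≤ I.unmatchedInd T M := by
  unfold unmatchedInd; split_ifs <;> norm_num

theorem unmatchedInd_insert (T : Finset (Fin I.servers)) (s : Fin I.servers)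
    (M : Finset (Fin I.servers × Fin I.requests)) :
    I.unmatchedInd (insert s T) M = I.unmatchedInd T M * I.unmatchedInd {s} M := by
  unfold unmatchedInd
  by_cases h1 : ∀ s ∈ T, ∀ r, (s, r) ∉ M <;> by_cases h2 : ∀ r, (s, r) ∉ M <;>
    simp [h1, h2]

theorem unmatchedInd_insert_edge (T : Finset (Fin I.servers)) (s : Fin I.servers)
    (r : Fin I.requests) (M : Finset (Fin I.servers × Fin I.requests)) :
    I.unmatchedInd T (insert (s, r) M) = if s ∈ T then 0 else I.unmatchedInd T M := by
  unfold unmatchedInd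
  split_ifs with h1 h2 h3 h2 h3
  · exact absurd (Finset.mem_insert_self _ _) (h1 s h2 r)
  · rfl
  · exact absurd (fun s' hs' r' hm => h1 s' hs' r' (Finset.mem_insert_of_mem hm)) h3
  · rfl
  · refine absurd (fun s' hs' r' hm => ?_) h1
    rcases Finset.mem_insert.1 hm with h | h
    · obtain rfl : s' = s := (Prod.ext_iff.1 h).1
      exact h2 hs'
    · exact h3 s' hs' r' h
  · rfl

variable (w : WeightSeq)

theorem ocsStep_expect_of_disjoint (r : Fin I.requests) (T : Finset (Fin I.servers))
    (hT : T ∩ I.nbr r = ∅) (M : Finset (Fin I.servers × Fin I.requests)) :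
    (I.ocsStep w r M).expect (I.unmatchedInd T) = I.unmatchedInd T M := by
  unfold ocsStep
  split_ifs with hA
  · rw [PMF.expect_map, weightedChoice_expect]
    have hpos : 0 < ∑ s ∈ I.available r M, w.f (I.degBefore r s) :=
      Finset.sum_pos (fun s _ => w.pos _) hA
    rw [div_eq_iff hpos.ne', Finset.mul_sum]
    refine Finset.sum_congr rfl fun s hs => ?_
    have hsT : s ∉ T := fun h => by
      have : s ∈ T ∩ I.nbr r := Finset.mem_inter.2 ⟨h, (Finset.mem_filter.1 hs).1⟩
      rw [hT] at this
      exact absurd this (Finset.notMem_empty s)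
    rw [unmatchedInd_insert_edge, if_neg hsT, mul_comm]
  · rw [PMF.expect_pure]

/-- The total weight of the unmatched neighbours of `r` outside `T`. -/
def outerWeight (r : Fin I.requests) (T : Finset (Fin I.servers))
    (M : Finset (Fin I.servers × Fin I.requests)) : ℝ :=
  ∑ s ∈ I.nbr r \ T, w.f (I.degBefore r s) * I.unmatchedInd {s} M

/-- While `T` is unmatched, all of `T ∩ N(r)` is available, so `T` survives exactly when the choice
falls outside `T`. Once `T` is hit, both sides vanish. -/
theorem ocsStep_expect_of_inter (r : Fin I.requests) (T : Finset (Fin I.servers))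
    (hT : (T ∩ I.nbr r).Nonempty) (M : Finset (Fin I.servers × Fin I.requests)) :
    (I.ocsStep w r M).expect (I.unmatchedInd T) = I.unmatchedInd T M *
      (I.outerWeight w r T M /
        (∑ s ∈ T ∩ I.nbr r, w.f (I.degBefore r s) + I.outerWeight w r T M)) := by
  have houter : I.outerWeight w r T M =
      ∑ s ∈ I.available r M \ T, w.f (I.degBefore r s) := by
    have : I.available r M \ T = (I.nbr r \ T).filter fun s => ∀ r', (s, r') ∉ M := by
      ext s; simp only [available, Finset.mem_sdiff, Finset.mem_filter]; tauto
    rw [this, Finset.sum_filter, outerWeight]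
    refine Finset.sum_congr rfl fun s _ => ?_
    simp [unmatchedInd]
  by_cases hM : ∀ s ∈ T, ∀ r', (s, r') ∉ M
  · have hsub : I.available r M ∩ T = T ∩ I.nbr r := by
      ext s
      simp only [available, Finset.mem_inter, Finset.mem_filter]
      exact ⟨fun h => ⟨h.2, h.1.1⟩, fun h => ⟨⟨h.2, hM s h.1⟩, h.1⟩⟩
    have hA : (I.available r M).Nonempty :=
      (hsub ▸ hT : (I.available r M ∩ T).Nonempty).mono Finset.inter_subset_left
    rw [ocsStep, dif_pos hA, PMF.expect_map, weightedChoice_expect, houter, ← hsub,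
      Finset.sum_inter_add_sum_sdiff, ← mul_div_assoc]
    congr 1
    rw [← Finset.sum_inter_add_sum_sdiff (I.available r M) T, Finset.mul_sum,
      Finset.sum_eq_zero, zero_add]
    · refine Finset.sum_congr rfl fun s hs => ?_
      rw [unmatchedInd_insert_edge, if_neg (Finset.mem_sdiff.1 hs).2, mul_comm]
    · intro s hs
      rw [unmatchedInd_insert_edge, if_pos (Finset.mem_inter.1 hs).2, mul_zero]
  · have h0 : I.unmatchedInd T M = 0 := by rw [unmatchedInd, if_neg hM]
    rw [h0, zero_mul, ocsStep]
    split_ifs with hA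
    · rw [PMF.expect_map, weightedChoice_expect, Finset.sum_eq_zero, zero_div]
      intro s _
      rw [unmatchedInd_insert_edge, h0, ite_self, mul_zero]
    · rw [PMF.expect_pure, h0]

theorem ocsRun_succ (r : Fin I.requests) :
    I.ocsRun w (r + 1) = (I.ocsRun w r).bind (I.ocsStep w r) := by
  rw [ocsRun, dif_pos r.isLt]

/-- One round of the algorithm preserves the product bound. -/
theorem ocsStep_expect_le (d k : ℕ) (hd : 2 ≤ d) (hI : I.IsBounded k d) (r : Fin I.requests)
    (p : PMF (Finset (Fin I.servers × Fin I.requests)))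
    (hp : ∀ T, p.expect (I.unmatchedInd T) ≤
      ∏ s ∈ T, (optimalCandidateFun d hd (I.degUpTo r s))⁻¹) (T : Finset (Fin I.servers)) :
    (p.bind (I.ocsStep (optimalCandidate d hd) r)).expect (I.unmatchedInd T) ≤
      ∏ s ∈ T, (optimalCandidateFun d hd (I.degUpTo (r + 1) s))⁻¹ := by
  set f := optimalCandidateFun d hd with hf
  have hfpos : ∀ n, 0 < f n := optimalCandidateFun_pos d hd
  have hwf : (optimalCandidate d hd).f = f := rfl
  rw [PMF.expect_bind]
  rcases Finset.eq_empty_or_nonempty (T ∩ I.nbr r) with hT | hT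
  · simp_rw [ocsStep_expect_of_disjoint I _ r T hT]
    refine (hp T).trans_eq (Finset.prod_congr rfl fun s hs => ?_)
    rw [degUpTo_succ, if_neg fun h => by
      have : s ∈ T ∩ I.nbr r := Finset.mem_inter.2 ⟨hs, h⟩
      rw [hT] at this
      exact absurd this (Finset.notMem_empty s)]
  · simp_rw [ocsStep_expect_of_inter I _ r T hT]
    set U := T ∩ I.nbr r with hU
    set B := ∏ s ∈ T, (f (I.degUpTo r s))⁻¹ with hB
    have hBpos : 0 < B := Finset.prod_pos fun s _ => inv_pos.2 (hfpos _)
    set F := ∑ s ∈ U, (optimalCandidate d hd).f (I.degBefore r s) with hF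
    have hFpos : 0 < F := Finset.sum_pos (fun s _ => hfpos _) hT
    have hcard : U.card + (I.nbr r \ T).card = (I.nbr r).card := by
      rw [hU, Finset.inter_comm]; exact Finset.card_inter_add_card_sdiff _ _
    have hrd : (I.nbr r).card ≤ d := hI.2 r
    set D : ℝ := (d : ℝ) - U.card with hD
    have hDge : ((I.nbr r \ T).card : ℝ) ≤ D := by
      have : (U.card + (I.nbr r \ T).card : ℝ) ≤ d := by exact_mod_cast hcard.trans_le hrd
      linarith
    have hD0 : 0 ≤ D := le_trans (Nat.cast_nonneg _) hDge
    have hX0 : ∀ M, 0 ≤ I.outerWeight (optimalCandidate d hd) r T M := fun M =>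
      Finset.sum_nonneg fun s _ => mul_nonneg (hfpos _).le (I.unmatchedInd_nonneg _ _)
    have hUX : (p.expect fun M => I.unmatchedInd T M *
        I.outerWeight (optimalCandidate d hd) r T M) ≤ D * B := by
      -- Products of indicators are indicators of larger sets, so the hypothesis applies to `insert
      -- s T`; its new factor cancels the weight of `s`.
      have : ∀ M, I.unmatchedInd T M * I.outerWeight (optimalCandidate d hd) r T M =
          ∑ s ∈ I.nbr r \ T, f (I.degUpTo r s) * I.unmatchedInd (insert s T) M := fun M => by
        rw [outerWeight, Finset.mul_sum]
        refine Finset.sum_congr rfl fun s _ => ?_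
        rw [unmatchedInd_insert, hwf, degUpTo_eq_degBefore]
        ring
      simp_rw [this]
      rw [PMF.expect_sum]
      calc _ ≤ ∑ s ∈ I.nbr r \ T, B := Finset.sum_le_sum fun s hs => by
            rw [PMF.expect_const_mul]
            refine (mul_le_mul_of_nonneg_left (hp _) (hfpos _).le).trans_eq ?_
            rw [Finset.prod_insert (Finset.mem_sdiff.1 hs).2, ← mul_assoc,
              mul_inv_cancel₀ (hfpos _).ne', one_mul]
        _ = ((I.nbr r \ T).card : ℝ) * B := by rw [Finset.sum_const, nsmul_eq_mul]
        _ ≤ D * B := mul_le_mul_of_nonneg_right hDge hBpos.le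
    have hmain : (p.expect fun M => I.unmatchedInd T M *
        (I.outerWeight (optimalCandidate d hd) r T M /
          (F + I.outerWeight (optimalCandidate d hd) r T M))) ≤ B * (D / (F + D)) := by
      -- The tangent replaces Jensen's inequality: its slope and intercept are nonnegative, so the
      -- upper bounds on both expectations can be inserted.
      calc _ ≤ p.expect fun M => D ^ 2 / (F + D) ^ 2 * I.unmatchedInd T M +
            F / (F + D) ^ 2 *
              (I.unmatchedInd T M * I.outerWeight (optimalCandidate d hd) r T M) := by
            refine p.expect_mono fun M => ?_
            refine (mul_le_mul_of_nonneg_left (div_add_le_tangent hFpos (hX0 M) hD0)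
              (I.unmatchedInd_nonneg T M)).trans_eq ?_
            ring
        _ = D ^ 2 / (F + D) ^ 2 * p.expect (I.unmatchedInd T) + F / (F + D) ^ 2 *
            (p.expect fun M => I.unmatchedInd T M *
              I.outerWeight (optimalCandidate d hd) r T M) := by
            rw [PMF.expect_add, PMF.expect_const_mul, PMF.expect_const_mul]
        _ ≤ D ^ 2 / (F + D) ^ 2 * B + F / (F + D) ^ 2 * (D * B) := by
            gcongr
            exact hp T
        _ = B * (D / (F + D)) := by
            have : F + D ≠ 0 := by positivity
            field_simp
            ring
    refine hmain.trans ?_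
    have hsplit : ∏ s ∈ T, (f (I.degUpTo (r + 1) s))⁻¹ =
        (∏ s ∈ U, (f (I.degUpTo r s + 1))⁻¹) * ∏ s ∈ T \ I.nbr r, (f (I.degUpTo r s))⁻¹ := by
      rw [← Finset.prod_inter_mul_prod_sdiff T (I.nbr r)]
      congr 1
      · exact Finset.prod_congr rfl fun s hs => by
          rw [degUpTo_succ, if_pos (Finset.mem_inter.1 hs).2]
      · exact Finset.prod_congr rfl fun s hs => by
          rw [degUpTo_succ, if_neg (Finset.mem_sdiff.1 hs).2]
    rw [hsplit, hB, ← Finset.prod_inter_mul_prod_sdiff T (I.nbr r), mul_right_comm]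
    refine mul_le_mul_of_nonneg_right ?_ (Finset.prod_nonneg fun s _ => (inv_pos.2 (hfpos _)).le)
    rw [Finset.prod_inv_distrib, Finset.prod_inv_distrib]
    have hP0 : 0 < ∏ s ∈ U, f (I.degUpTo r s) := Finset.prod_pos fun s _ => hfpos _
    have hP1 : 0 < ∏ s ∈ U, f (I.degUpTo r s + 1) := Finset.prod_pos fun s _ => hfpos _
    -- The growth condition needs `|U| < d`. If `|U| = d`, then `N(r) ⊆ T` and the survival bound is
    -- `0`.
    rcases hD0.eq_or_lt with h0 | h0
    · rw [← h0, zero_div, mul_zero]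
      exact (inv_pos.2 hP1).le
    · have hlt : U.card < d := by
        have : (U.card : ℝ) < d := by linarith
        exact_mod_cast this
      have key := optimalCandidateFun_prod_le d hd U hT hlt (I.degUpTo r)
      have hFD : 0 < F + D := by linarith
      rw [← div_eq_inv_mul, div_div, div_le_iff₀ (by positivity), ← div_eq_inv_mul,
        le_div_iff₀ hP1, mul_comm]
      refine key.trans_eq ?_
      rw [mul_comm, hF]
      rfl

/-- After `j` requests, all servers of `T` are unmatched with probability at most
`∏ s ∈ T, 1 / f*(l_s)`, with `l_s` the number of neighbours of `s` so far. -/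
theorem ocsRun_expect_unmatchedInd_le (d k : ℕ) (hd : 2 ≤ d) (hI : I.IsBounded k d) (j : ℕ)
    (hj : j ≤ I.requests) (T : Finset (Fin I.servers)) :
    (I.ocsRun (optimalCandidate d hd) j).expect (I.unmatchedInd T) ≤
      ∏ s ∈ T, (optimalCandidateFun d hd (I.degUpTo j s))⁻¹ := by
  induction j generalizing T with
  | zero =>
    rw [ocsRun, PMF.expect_pure]
    simp [unmatchedInd, degUpTo, optimalCandidateFun]
  | succ j ih =>
    rw [I.ocsRun_succ _ ⟨j, hj⟩]
    exact I.ocsStep_expect_le d k hd hI ⟨j, hj⟩ _ (ih (Nat.le_of_succ_le hj)) T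

/-! ### From unmatched servers to the competitive ratio. -/

/-- The sum counts the servers covered by `M`. An inequality suffices, so it need not be shown that
the run yields a matching. -/
theorem sum_one_sub_unmatchedInd_le_card (M : Finset (Fin I.servers × Fin I.requests)) :
    ∑ s, (1 - I.unmatchedInd {s} M) ≤ M.card := by
  have : ∑ s, (1 - I.unmatchedInd {s} M) = ((M.image Prod.fst).card : ℝ) := by
    rw [Finset.card_eq_sum_ones, Nat.cast_sum, ← Finset.sum_subset (Finset.subset_univ _)]
    · refine Finset.sum_congr rfl fun s hs => ?_
      obtain ⟨⟨s', r⟩, he, rfl⟩ := Finset.mem_image.1 hs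
      rw [unmatchedInd, if_neg fun h => h s' (Finset.mem_singleton_self _) r he]
      simp
    · intro s _ hs
      rw [unmatchedInd, if_pos, sub_self]
      intro s' hs' r he
      rw [Finset.mem_singleton.1 hs'] at he
      exact hs (Finset.mem_image_of_mem Prod.fst he)
  rw [this]
  exact_mod_cast Finset.card_image_le

theorem le_ocsExpected (d k : ℕ) (hd : 2 ≤ d) (hI : I.IsBounded k d) :
    (I.servers : ℝ) * (1 - (optimalCandidateFun d hd k)⁻¹) ≤
      I.ocsExpected (optimalCandidate d hd) := by
  have h1 : I.ocsExpected (optimalCandidate d hd) =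
      (I.ocsRun (optimalCandidate d hd) I.requests).expect fun M => (M.card : ℝ) := rfl
  rw [h1]
  refine le_trans ?_ (PMF.expect_mono _ I.sum_one_sub_unmatchedInd_le_card)
  rw [PMF.expect_sum]
  calc _ = ∑ _s : Fin I.servers, (1 - (optimalCandidateFun d hd k)⁻¹) := by
        rw [Finset.sum_const, Finset.card_univ, Fintype.card_fin, nsmul_eq_mul]
    _ ≤ _ := Finset.sum_le_sum fun s _ => by
        have hs := I.ocsRun_expect_unmatchedInd_le d k hd hI I.requests le_rfl {s}
        rw [Finset.prod_singleton] at hs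
        have hdeg : k ≤ I.degUpTo I.requests s := by
          refine (hI.1 s).trans_eq ?_
          simp [degUpTo]
        have hmono := (optimalCandidate d hd).mono hdeg
        have hinv : (optimalCandidateFun d hd (I.degUpTo I.requests s))⁻¹ ≤
            (optimalCandidateFun d hd k)⁻¹ :=
          inv_anti₀ (optimalCandidateFun_pos d hd k) hmono
        have : (fun M => 1 - I.unmatchedInd {s} M) =
            fun M => 1 + (-1) * I.unmatchedInd {s} M := by ext M; ring
        rw [this, PMF.expect_add, PMF.expect_const, PMF.expect_const_mul]
        linarith

theorem opt_le_servers : I.opt ≤ I.servers := by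
  classical
  refine Finset.sup_le fun M hM => ?_
  have hM' := (Finset.mem_filter.1 hM).2
  have hinj : Set.InjOn Prod.fst (M : Set (Fin I.servers × Fin I.requests)) :=
    fun e he e' he' h => hM'.2 e he e' he' (Or.inl h)
  rw [← Finset.card_image_of_injOn hinj]
  exact (Finset.card_le_univ _).trans_eq (Fintype.card_fin _)

/-- The real infimum of the empty set is `0`, so a lower bound on the ratio needs some admissible
instance. -/
theorem exists_isBounded (k d : ℕ) (hk : 1 ≤ k) (hd : 1 ≤ d) :
    ∃ I : OnlineInstance, I.IsBounded k d ∧ 0 < I.opt := by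
  classical
  refine ⟨⟨1, k, fun _ => Finset.univ⟩, ⟨fun s => by simp [Subsingleton.elim s (0 : Fin 1)], fun r => by simpa using hd⟩, ?_⟩
  refine Nat.lt_of_lt_of_le Nat.one_pos ?_
  unfold opt
  refine le_trans ?_ (Finset.le_sup (f := Finset.card)
    (b := {((0 : Fin 1), (⟨0, hk⟩ : Fin k))}) ?_)
  · simp
  · refine Finset.mem_filter.2 ⟨Finset.mem_univ _, fun e _ => Finset.mem_univ _, ?_⟩
    intro e he e' he' _
    rw [Finset.mem_singleton.1 he, Finset.mem_singleton.1 he']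

end OnlineInstance

theorem le_ocsCompetitiveRatio (d k : ℕ) (hd : 2 ≤ d) (hk : 1 ≤ k) :
    1 - (optimalCandidateFun d hd k)⁻¹ ≤ ocsCompetitiveRatio (optimalCandidate d hd) k d := by
  obtain ⟨I₀, hI₀, hopt₀⟩ := OnlineInstance.exists_isBounded k d hk (by omega)
  refine le_csInf ⟨_, I₀, hI₀, hopt₀, rfl⟩ ?_
  rintro ρ ⟨I, hI, hopt, rfl⟩
  rw [le_div_iff₀ (by exact_mod_cast hopt)]
  refine le_trans ?_ (I.le_ocsExpected d k hd hI)
  rw [mul_comm]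
  have h1 : 1 ≤ optimalCandidateFun d hd k := by
    have := (optimalCandidate d hd).mono (Nat.zero_le k)
    rwa [(optimalCandidate d hd).zero] at this
  exact mul_le_mul_of_nonneg_right (by exact_mod_cast I.opt_le_servers)
    (sub_nonneg.2 (inv_le_one_of_one_le₀ h1))

/-! ### Growth rates and the shape of `x ↦ (1 - x) * exp (c * x)`. -/

/-- A condition under which the sequence `f*_d`, once it is at least `F`, grows at least by the
factor `exp (c / d)` in each step, for every `d` (`HasGrowth.mul_exp_le_succ`). -/
def HasGrowth (F c : ℝ) : Prop :=
  ∀ x : ℝ, 0 < x → x < 1 → (1 - x) * Real.exp (c * x) ≤ 1 + (F - 1) * x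

theorem hasDerivAt_one_sub_mul_exp (c x : ℝ) :
    HasDerivAt (fun x : ℝ => (1 - x) * Real.exp (c * x))
      ((c * (1 - x) - 1) * Real.exp (c * x)) x := by
  have h1 : HasDerivAt (fun x : ℝ => 1 - x) (-1) x := by
    simpa using (hasDerivAt_id x).const_sub 1
  have h2 : HasDerivAt (fun x : ℝ => Real.exp (c * x)) (Real.exp (c * x) * c) x := by
    simpa using ((hasDerivAt_id x).const_mul c).exp
  exact (h1.mul h2).congr_deriv (by ring)

theorem hasDerivAt_deriv_one_sub_mul_exp (c x : ℝ) :
    HasDerivAt (fun x : ℝ => (c * (1 - x) - 1) * Real.exp (c * x))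
      (c * (c * (1 - x) - 2) * Real.exp (c * x)) x := by
  have h1 : HasDerivAt (fun x : ℝ => c * (1 - x) - 1) (-c) x := by
    simpa using (((hasDerivAt_id x).const_sub 1).const_mul c).sub_const 1
  have h2 : HasDerivAt (fun x : ℝ => Real.exp (c * x)) (Real.exp (c * x) * c) x := by
    simpa using ((hasDerivAt_id x).const_mul c).exp
  exact (h1.mul h2).congr_deriv (by ring)

theorem deriv_one_sub_mul_exp (c : ℝ) :
    deriv (fun x : ℝ => (1 - x) * Real.exp (c * x)) =
      fun x : ℝ => (c * (1 - x) - 1) * Real.exp (c * x) :=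
  funext fun x => (hasDerivAt_one_sub_mul_exp c x).deriv

theorem deriv2_one_sub_mul_exp (c x : ℝ) :
    deriv^[2] (fun x : ℝ => (1 - x) * Real.exp (c * x)) x =
      c * (c * (1 - x) - 2) * Real.exp (c * x) := by
  rw [Function.iterate_succ, Function.iterate_one, Function.comp_apply, deriv_one_sub_mul_exp]
  exact (hasDerivAt_deriv_one_sub_mul_exp c x).deriv

theorem convexOn_one_sub_mul_exp {c : ℝ} (hc : 0 < c) :
    ConvexOn ℝ (Set.Icc 0 (1 - 2 / c)) fun x : ℝ => (1 - x) * Real.exp (c * x) := by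
  refine convexOn_of_deriv2_nonneg' (convex_Icc _ _)
    (fun x _ => (hasDerivAt_one_sub_mul_exp c x).differentiableAt.differentiableWithinAt) ?_ ?_
  · rw [deriv_one_sub_mul_exp]
    exact fun x _ =>
      (hasDerivAt_deriv_one_sub_mul_exp c x).differentiableAt.differentiableWithinAt
  · intro x hx
    rw [deriv2_one_sub_mul_exp]
    have : 2 / c ≤ 1 - x := by linarith [hx.2]
    rw [div_le_iff₀' hc] at this
    exact mul_nonneg (mul_nonneg hc.le (by linarith)) (Real.exp_pos _).le

theorem concaveOn_one_sub_mul_exp {c : ℝ} (hc : 0 < c) :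
    ConcaveOn ℝ (Set.Icc (1 - 2 / c) 1) fun x : ℝ => (1 - x) * Real.exp (c * x) := by
  refine concaveOn_of_deriv2_nonpos' (convex_Icc _ _)
    (fun x _ => (hasDerivAt_one_sub_mul_exp c x).differentiableAt.differentiableWithinAt) ?_ ?_
  · rw [deriv_one_sub_mul_exp]
    exact fun x _ =>
      (hasDerivAt_deriv_one_sub_mul_exp c x).differentiableAt.differentiableWithinAt
  · intro x hx
    rw [deriv2_one_sub_mul_exp]
    have : 1 - x ≤ 2 / c := by linarith [hx.1]
    rw [le_div_iff₀' hc] at this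
    exact mul_nonpos_of_nonpos_of_nonneg
      (mul_nonpos_of_nonneg_of_nonpos hc.le (by linarith)) (Real.exp_pos _).le

theorem one_sub_mul_exp_le_tangent {c y x : ℝ} (hc : 0 < c)
    (hy : y ∈ Set.Icc (1 - 2 / c) 1) (hx : x ∈ Set.Icc (1 - 2 / c) 1) :
    (1 - x) * Real.exp (c * x) ≤
      Real.exp (c * y) * ((1 - y) + (c * (1 - y) - 1) * (x - y)) := by
  have hconc := concaveOn_one_sub_mul_exp hc
  have hder := hasDerivAt_one_sub_mul_exp c y
  rcases lt_trichotomy x y with h | rfl | h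
  · have := hconc.le_slope_of_hasDerivAt hx hy h hder
    rw [slope_def_field, le_div_iff₀ (sub_pos.2 h)] at this
    nlinarith [this]
  · simp [mul_comm]
  · have := hconc.slope_le_of_hasDerivAt hy hx h hder
    rw [slope_def_field, div_le_iff₀ (sub_pos.2 h)] at this
    nlinarith [this]

/-- A criterion for `HasGrowth`, from the tangent to `x ↦ (1 - x) * exp (c * x)` at a point `y`
of the interval on which this function is concave. -/
theorem hasGrowth_of_tangent {F c y E : ℝ} (hc : 2 < c) (hy0 : 1 - 2 / c ≤ y) (hy1 : y ≤ 1)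
    (hE : Real.exp (c * y) ≤ E)
    (h0 : 0 ≤ (1 - y) + (c * (1 - y) - 1) * (1 - 2 / c - y))
    (h1 : E * ((1 - y) + (c * (1 - y) - 1) * (1 - 2 / c - y)) ≤ 1 + (F - 1) * (1 - 2 / c))
    (h2 : E * (c * (1 - y) ^ 2) ≤ F) : HasGrowth F c := by
  intro x hx0 hx1
  have hc0 : 0 < c := by linarith
  set v := 1 - 2 / c with hv
  have hv1 : v < 1 := by rw [hv]; linarith [div_pos two_pos hc0]
  have hv0 : 0 < v := by rw [hv, sub_pos, div_lt_one hc0]; exact hc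
  have hymem : y ∈ Set.Icc v 1 := ⟨hy0, hy1⟩
  set G := Real.exp (c * y) with hG
  have e1 : G * ((1 - y) + (c * (1 - y) - 1) * (v - y)) ≤ 1 + (F - 1) * v :=
    (mul_le_mul_of_nonneg_right hE h0).trans h1
  have e2 : G * ((1 - y) + (c * (1 - y) - 1) * (1 - y)) ≤ F := by
    refine le_trans (le_of_eq ?_)
      ((mul_le_mul_of_nonneg_right hE (by positivity : 0 ≤ c * (1 - y) ^ 2)).trans h2)
    ring
  rcases le_total v x with hvx | hvx
  -- Beyond the inflection point `v`, tangent and target are both affine in `x`, so comparing them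
  -- at `v` and at `1` is enough.
  · refine (one_sub_mul_exp_le_tangent hc0 hymem ⟨hvx, hx1.le⟩).trans ?_
    have hpos : 0 < 1 - v := by linarith
    have a1 := mul_le_mul_of_nonneg_left e1 (sub_nonneg.2 hx1.le)
    have a2 := mul_le_mul_of_nonneg_left e2 (sub_nonneg.2 hvx)
    refine le_of_mul_le_mul_left ?_ hpos
    calc (1 - v) * (G * ((1 - y) + (c * (1 - y) - 1) * (x - y)))
        = (1 - x) * (G * ((1 - y) + (c * (1 - y) - 1) * (v - y))) +
          (x - v) * (G * ((1 - y) + (c * (1 - y) - 1) * (1 - y))) := by ring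
      _ ≤ (1 - x) * (1 + (F - 1) * v) + (x - v) * F := add_le_add a1 a2
      _ = _ := by ring
  -- Before `v` the function is convex, hence below its chord; the target line also has value `1` at
  -- `0`, so again only `v` matters.
  · have hv' := (one_sub_mul_exp_le_tangent hc0 hymem ⟨le_rfl, hv1.le⟩).trans e1
    have hconv := (convexOn_one_sub_mul_exp hc0).2
      (show (0 : ℝ) ∈ Set.Icc 0 v from ⟨le_rfl, hv0.le⟩)
      (show v ∈ Set.Icc 0 v from ⟨hv0.le, le_rfl⟩)
      (show 0 ≤ 1 - x / v from sub_nonneg.2 ((div_le_one hv0).2 hvx))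
      (show 0 ≤ x / v by positivity) (by ring)
    have hxv : x / v * v = x := div_mul_cancel₀ _ hv0.ne'
    simp only [smul_eq_mul, mul_zero, zero_add, hxv, sub_zero, Real.exp_zero, mul_one] at hconv
    refine hconv.trans ?_
    have := mul_le_mul_of_nonneg_left hv' (by positivity : 0 ≤ x / v)
    calc _ ≤ 1 - x / v + x / v * (1 + (F - 1) * v) := by linarith
      _ = 1 + (F - 1) * (x / v * v) := by ring
      _ = _ := by rw [hxv]

/-- This is `2x ≤ log ((1 + x) / (1 - x))`, obtained from `log (1 + z) ≥ 2z / (z + 2)` at `z = 2x /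
(1 - x)`. -/
theorem one_sub_mul_exp_two_mul_le {x : ℝ} (hx0 : 0 < x) (hx1 : x < 1) :
    (1 - x) * Real.exp (2 * x) ≤ 1 + x := by
  have h1 : 0 < 1 - x := sub_pos.2 hx1
  have h := Real.le_log_one_add_of_nonneg (x := 2 * x / (1 - x)) (by positivity)
  have e1 : 2 * (2 * x / (1 - x)) / (2 * x / (1 - x) + 2) = 2 * x := by
    have : 2 * x / (1 - x) + 2 = 2 / (1 - x) := by field_simp; ring
    rw [this]
    field_simp
  have e2 : 1 + 2 * x / (1 - x) = (1 + x) / (1 - x) := by field_simp; ring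
  rw [e1, e2, Real.le_log_iff_exp_le (by positivity), le_div_iff₀ h1] at h
  linarith

/-- Up to the value `2`, the growth rate is the value itself. -/
theorem hasGrowth_self {F : ℝ} (h0 : 0 ≤ F) (h2 : F ≤ 2) : HasGrowth F F := by
  intro x hx0 hx1
  have h1 : 0 < 1 - x := sub_pos.2 hx1
  -- Convexity of `exp` between `0` and `2x` reduces every `F ≤ 2` to the case `F = 2`.
  have hconv := convexOn_exp.2 (Set.mem_univ 0) (Set.mem_univ (2 * x))
    (show 0 ≤ 1 - F / 2 by linarith) (show 0 ≤ F / 2 by linarith) (by ring)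
  have hx : F / 2 * (2 * x) = F * x := by ring
  simp only [smul_eq_mul, mul_zero, zero_add, hx, Real.exp_zero, mul_one] at hconv
  have h := mul_le_mul_of_nonneg_left (one_sub_mul_exp_two_mul_le hx0 hx1)
    (by linarith : 0 ≤ F / 2)
  calc _ ≤ (1 - x) * (1 - F / 2 + F / 2 * Real.exp (2 * x)) :=
        mul_le_mul_of_nonneg_left hconv h1.le
    _ = (1 - x) * (1 - F / 2) + F / 2 * ((1 - x) * Real.exp (2 * x)) := by ring
    _ ≤ (1 - x) * (1 - F / 2) + F / 2 * (1 + x) := by linarith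
    _ = _ := by ring

/-! ### Growth of `f*_d` over many steps. -/

section

variable {d : ℕ} {hd : 2 ≤ d}

/-- At `x = m / d`, dividing the growth condition by `1 - x` gives `exp (c * m / d) ≤ 1 + m * F / (d
- m)`, which handles every term of the minimum, uniformly in `d`. -/
theorem HasGrowth.mul_exp_le_succ {F c : ℝ} (h : HasGrowth F c) {l : ℕ}
    (hl : F ≤ optimalCandidateFun d hd l) :
    optimalCandidateFun d hd l * Real.exp (c / d) ≤ optimalCandidateFun d hd (l + 1) := by
  rw [optimalCandidateFun]
  refine mul_le_mul_of_nonneg_left ?_ (optimalCandidateFun_pos d hd l).le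
  rw [Finset.le_inf'_iff]
  intro m hm
  obtain ⟨hm1, hmd⟩ := Finset.mem_Ico.1 hm
  set f := optimalCandidateFun d hd l
  have hm0 : (0 : ℝ) < m := by exact_mod_cast hm1
  have hmd' : (m : ℝ) < d := by exact_mod_cast hmd
  have hd0 : (0 : ℝ) < d := hm0.trans hmd'
  have hdm : 0 < (d : ℝ) - m := sub_pos.2 hmd'
  have hgr := h (m / d) (div_pos hm0 hd0) ((div_lt_one hd0).2 hmd')
  have key : Real.exp (c / d) ^ (m : ℝ) ≤ 1 + (m : ℝ) * f / ((d : ℝ) - m) := by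
    rw [← Real.exp_mul]
    have e1 : c / d * m = c * (m / d) := by ring
    have e2 : 1 + (m : ℝ) * f / ((d : ℝ) - m) = (d - m + m * f) / ((d : ℝ) - m) := by
      field_simp
    rw [e1, e2, le_div_iff₀ hdm]
    have h3 := mul_le_mul_of_nonneg_left hgr hd0.le
    have e3 : (d : ℝ) * ((1 - m / d) * Real.exp (c * (m / d))) =
        Real.exp (c * (m / d)) * (d - m) := by field_simp
    have e4 : (d : ℝ) * (1 + (F - 1) * (m / d)) = d - m + m * F := by field_simp; ring
    rw [e3, e4] at h3
    have := mul_le_mul_of_nonneg_left hl hm0.le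
    linarith
  calc Real.exp (c / d) = (Real.exp (c / d) ^ (m : ℝ)) ^ ((1 : ℝ) / m) := by
        rw [← Real.rpow_mul (Real.exp_pos _).le, mul_one_div_cancel hm0.ne', Real.rpow_one]
    _ ≤ _ := Real.rpow_le_rpow (by positivity) key (by positivity)

theorem HasGrowth.mul_exp_le_add {F c : ℝ} (h : HasGrowth F c) {l : ℕ}
    (hl : F ≤ optimalCandidateFun d hd l) (j : ℕ) :
    optimalCandidateFun d hd l * Real.exp (c * j / d) ≤ optimalCandidateFun d hd (l + j) := by
  induction j with
  | zero => simp
  | succ j ih =>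
    have hmono : optimalCandidateFun d hd l ≤ optimalCandidateFun d hd (l + j) :=
      (optimalCandidate d hd).mono (Nat.le_add_right l j)
    have h1 := h.mul_exp_le_succ (hl.trans hmono)
    refine le_trans ?_ h1
    have : c * ((j + 1 : ℕ) : ℝ) / d = c * j / d + c / d := by push_cast; ring
    rw [this, Real.exp_add, ← mul_assoc]
    exact mul_le_mul_of_nonneg_right ih (Real.exp_pos _).le

/-- The time `t * d` (rounded up) suffices to grow from `F` to `F'`, if
`F' ≤ F * (1 + y + y ^ 2 / 2 + y ^ 3 / 6)` with `y = c * t`. -/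
theorem HasGrowth.exists_le {F c : ℝ} (h : HasGrowth F c) {t F' σ n : ℝ} (hF : 0 ≤ F)
    (hc : 0 ≤ c) (ht : 0 ≤ t)
    (hF' : F' ≤ F * (1 + c * t + (c * t) ^ 2 / 2 + (c * t) ^ 3 / 6))
    (hl : ∃ l : ℕ, (l : ℝ) ≤ σ * d + n ∧ F ≤ optimalCandidateFun d hd l) :
    ∃ l : ℕ, (l : ℝ) ≤ (σ + t) * d + (n + 1) ∧ F' ≤ optimalCandidateFun d hd l := by
  obtain ⟨l, hl1, hl2⟩ := hl
  have hd0 : (0 : ℝ) < d := by exact_mod_cast (by omega : 0 < d)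
  have htd : 0 ≤ t * d := mul_nonneg ht hd0.le
  refine ⟨l + ⌈t * d⌉₊, ?_, ?_⟩
  · have := (Nat.ceil_lt_add_one htd).le
    push_cast
    linarith
  -- The cubic Taylor polynomial keeps the later numerical checks rational.
  · have hexp : 1 + c * t + (c * t) ^ 2 / 2 + (c * t) ^ 3 / 6 ≤ Real.exp (c * t) := by
      have := Real.sum_le_exp_of_nonneg (mul_nonneg hc ht) 4
      refine le_trans (le_of_eq ?_) this
      simp [Finset.sum_range_succ, Nat.factorial]
    have hle : c * t ≤ c * (⌈t * d⌉₊ : ℝ) / d := by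
      rw [le_div_iff₀ hd0, mul_assoc]
      exact mul_le_mul_of_nonneg_left (Nat.le_ceil _) hc
    calc F' ≤ F * Real.exp (c * t) := hF'.trans (mul_le_mul_of_nonneg_left hexp hF)
      _ ≤ optimalCandidateFun d hd l * Real.exp (c * (⌈t * d⌉₊ : ℝ) / d) :=
        mul_le_mul hl2 (Real.exp_le_exp.2 hle) (Real.exp_pos _).le (hF.trans hl2)
      _ ≤ _ := h.mul_exp_le_add hl2 _

/-- A discrete form of `f' = f ^ 2 / d`: below the value `2`, each step lowers `1 / f` by at least
`1 / (d + f) ≥ 1 / (d + 2)`. -/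
theorem two_le_or_inv_le (l : ℕ) : 2 ≤ optimalCandidateFun d hd l ∨
    (optimalCandidateFun d hd l)⁻¹ ≤ 1 - l / ((d : ℝ) + 2) := by
  have hd0 : (0 : ℝ) < d := by exact_mod_cast (by omega : 0 < d)
  induction l with
  | zero => right; simp [optimalCandidateFun]
  | succ l ih =>
    have hmono : optimalCandidateFun d hd l ≤ optimalCandidateFun d hd (l + 1) :=
      (optimalCandidate d hd).mono (Nat.le_succ l)
    rcases le_or_gt 2 (optimalCandidateFun d hd l) with h2 | h2
    · exact Or.inl (h2.trans hmono)
    · right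
      have ih := ih.resolve_left h2.not_ge
      have hpos := optimalCandidateFun_pos d hd l
      set f := optimalCandidateFun d hd l
      have hstep := (hasGrowth_self hpos.le h2.le).mul_exp_le_succ (hd := hd) (l := l) le_rfl
      have hlow : f * (1 + f / d) ≤ optimalCandidateFun d hd (l + 1) :=
        (mul_le_mul_of_nonneg_left (by linarith [Real.add_one_le_exp (f / d)]) hpos.le).trans
          hstep
      refine (inv_anti₀ (by positivity) hlow).trans ?_
      have e1 : (f * (1 + f / d))⁻¹ = f⁻¹ - 1 / (d + f) := by field_simp; ring
      have e2 : 1 / ((d : ℝ) + 2) ≤ 1 / (d + f) :=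
        one_div_le_one_div_of_le (by positivity) (by linarith)
      have e3 : ((l + 1 : ℕ) : ℝ) / ((d : ℝ) + 2) = l / ((d : ℝ) + 2) + 1 / ((d : ℝ) + 2) := by
        push_cast; ring
      rw [e1, e3]
      linarith

theorem exists_two_le :
    ∃ l : ℕ, (l : ℝ) ≤ 1 / 2 * d + 2 ∧ 2 ≤ optimalCandidateFun d hd l := by
  have hd0 : (0 : ℝ) < d := by exact_mod_cast (by omega : 0 < d)
  refine ⟨⌈((d : ℝ) + 2) / 2⌉₊, ?_, ?_⟩
  · have := (Nat.ceil_lt_add_one (by positivity : 0 ≤ ((d : ℝ) + 2) / 2)).le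
    linarith
  · rcases two_le_or_inv_le (hd := hd) ⌈((d : ℝ) + 2) / 2⌉₊ with h | h
    · exact h
    · have h1 : 1 / 2 ≤ (⌈((d : ℝ) + 2) / 2⌉₊ : ℝ) / ((d : ℝ) + 2) := by
        rw [le_div_iff₀ (by positivity)]
        linarith [Nat.le_ceil (((d : ℝ) + 2) / 2)]
      have h2 := h.trans (by linarith : _ ≤ (2 : ℝ)⁻¹)
      exact (inv_le_inv₀ (optimalCandidateFun_pos d hd _) two_pos).1 h2

end

/-! ### Numerical rates and the final bound. -/

theorem exp_half_mul_le (j : ℕ) {x : ℝ} (hx : x = j / 2) : Real.exp x ≤ 1.6488 ^ j := by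
  have h : Real.exp (1 / 2) ≤ 1.6488 := by
    refine le_of_sq_le_sq ?_ (by norm_num)
    rw [← Real.exp_nat_mul]
    norm_num
    linarith [Real.exp_one_lt_d9]
  have : x = (j : ℝ) * (1 / 2) := by rw [hx]; ring
  rw [this, Real.exp_nat_mul]
  exact pow_le_pow_left₀ (Real.exp_pos _).le h j

/-- Here and in the next four rates, `y` is chosen so that `c * y` is `1/2, 1, 3/2, 2, 5/2` in turn;
then `exp (c * y)` is a power of `exp (1 / 2) ≤ 1.6488`. -/
theorem hasGrowth_first : HasGrowth 2.396 2.346 :=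
  hasGrowth_of_tangent (y := 250 / 1173) (by norm_num) (by norm_num) (by norm_num)
    (exp_half_mul_le 1 (by norm_num)) (by norm_num) (by norm_num) (by norm_num)

theorem hasGrowth_second : HasGrowth 2.953 2.718 :=
  hasGrowth_of_tangent (y := 500 / 1359) (by norm_num) (by norm_num) (by norm_num)
    (exp_half_mul_le 2 (by norm_num)) (by norm_num) (by norm_num) (by norm_num)

theorem hasGrowth_third : HasGrowth 3.741 3.111 :=
  hasGrowth_of_tangent (y := 500 / 1037) (by norm_num) (by norm_num) (by norm_num)
    (exp_half_mul_le 3 (by norm_num)) (by norm_num) (by norm_num) (by norm_num)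

theorem hasGrowth_fourth : HasGrowth 4.867 3.523 :=
  hasGrowth_of_tangent (y := 2000 / 3523) (by norm_num) (by norm_num) (by norm_num)
    (exp_half_mul_le 4 (by norm_num)) (by norm_num) (by norm_num) (by norm_num)

theorem hasGrowth_fifth : HasGrowth 6.489 3.95 :=
  hasGrowth_of_tangent (y := 50 / 79) (by norm_num) (by norm_num) (by norm_num)
    (exp_half_mul_le 5 (by norm_num)) (by norm_num) (by norm_num) (by norm_num)

/-- The sequence `f*_d` exceeds `3 * e` within the first `d` steps. -/
theorem exists_three_mul_exp_one_le (d : ℕ) (hd : 2 ≤ d) (hd' : 1000 ≤ d) :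
    ∃ l : ℕ, l ≤ d ∧ (8.157 : ℝ) ≤ optimalCandidateFun d hd l := by
  -- Each stage ends at the value where the next rate becomes valid; `t` is its duration in units of
  -- `d`.
  have h0 := (hasGrowth_self (F := 2) (by norm_num) le_rfl).exists_le (t := 0.0905)
    (F' := 2.396) (by norm_num) (by norm_num) (by norm_num) (by norm_num)
    (exists_two_le (hd := hd))
  have h1 := hasGrowth_first.exists_le (t := 0.0892) (F' := 2.953)
    (by norm_num) (by norm_num) (by norm_num) (by norm_num) h0
  have h2 := hasGrowth_second.exists_le (t := 0.0872) (F' := 3.741)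
    (by norm_num) (by norm_num) (by norm_num) (by norm_num) h1
  have h3 := hasGrowth_third.exists_le (t := 0.0847) (F' := 4.867)
    (by norm_num) (by norm_num) (by norm_num) (by norm_num) h2
  have h4 := hasGrowth_fourth.exists_le (t := 0.0818) (F' := 6.489)
    (by norm_num) (by norm_num) (by norm_num) (by norm_num) h3
  obtain ⟨l, hl, hle⟩ := hasGrowth_fifth.exists_le (t := 0.0581) (F' := 8.157)
    (by norm_num) (by norm_num) (by norm_num) (by norm_num) h4
  refine ⟨l, ?_, hle⟩
  have hd1 : (1000 : ℝ) ≤ d := by exact_mod_cast hd'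
  -- The durations sum to `0.9915` and the roundings to `8`, so `0.0085 * d ≥ 8` is needed; `d ≥
  -- 1000` ensures it.
  have : (l : ℝ) ≤ d := by
    norm_num at hl
    linarith
  exact_mod_cast this

theorem rpow_le_optimalCandidateFun (d : ℕ) (hd : 2 ≤ d) (hd' : 1000 ≤ d) (k : ℕ) (hk : d < k) :
    (3 * Real.exp 1) ^ ((k : ℝ) / (d : ℝ)) ≤ optimalCandidateFun d hd k := by
  obtain ⟨l, hld, hl⟩ := exists_three_mul_exp_one_le d hd hd'
  have hd0 : (0 : ℝ) < d := by exact_mod_cast (by omega : 0 < d)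
  have h3e : 0 < 3 * Real.exp 1 := by positivity
  obtain ⟨j, rfl⟩ := Nat.exists_eq_add_of_le (hld.trans hk.le)
  refine le_trans ?_ (hasGrowth_fifth.mul_exp_le_add (le_trans (by norm_num) hl) j)
  have hlj : ((l + j : ℕ) : ℝ) / d ≤ 1 + j / d := by
    rw [Nat.cast_add, add_div]
    have : (l : ℝ) / d ≤ 1 := (div_le_one hd0).2 (by exact_mod_cast hld)
    linarith
  have h31 : 1 ≤ 3 * Real.exp 1 := by linarith [Real.add_one_le_exp (1 : ℝ)]
  have h3 : (3 : ℝ) ≤ Real.exp 2 := by linarith [Real.add_one_le_exp (2 : ℝ)]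
  -- The value at `l ≤ d` pays for one factor `3e`. The remaining `j` steps only need a rate of at
  -- least `log (3e)`, and `3e ≤ exp 3` with `3 ≤ 3.95`.
  calc (3 * Real.exp 1) ^ (((l + j : ℕ) : ℝ) / (d : ℝ))
      ≤ (3 * Real.exp 1) ^ (1 + (j : ℝ) / d) := Real.rpow_le_rpow_of_exponent_le h31 hlj
    _ = 3 * Real.exp 1 * (3 * Real.exp 1) ^ ((j : ℝ) / d) := by
        rw [Real.rpow_add h3e, Real.rpow_one]
    _ ≤ optimalCandidateFun d hd l * Real.exp (3.95 * j / d) := by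
        refine mul_le_mul (le_trans (by linarith [Real.exp_one_lt_d9]) hl) ?_ (by positivity)
          (optimalCandidateFun_pos d hd l).le
        have hj : 0 ≤ (j : ℝ) / d := by positivity
        calc (3 * Real.exp 1) ^ ((j : ℝ) / d) ≤ (Real.exp 3) ^ ((j : ℝ) / d) := by
              refine Real.rpow_le_rpow h3e.le ?_ hj
              rw [show (3 : ℝ) = 2 + 1 by norm_num, Real.exp_add]
              exact mul_le_mul_of_nonneg_right (by linarith) (Real.exp_pos _).le
          _ = Real.exp (3 * (j / d)) := by rw [← Real.exp_mul]
          _ ≤ _ := Real.exp_le_exp.2 (by rw [mul_div_assoc]; linarith)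

theorem mainTheorem9 :
    ∃ d₀ : ℕ, ∀ (d : ℕ) (hd : 2 ≤ d), d₀ ≤ d → ∀ k : ℕ, d < k →
      1 - (1 / (3 * Real.exp 1)) ^ ((k : ℝ) / (d : ℝ)) ≤
        ocsCompetitiveRatio (optimalCandidate d hd) k d := by
  refine ⟨1000, fun d hd hd' k hk => ?_⟩
  refine le_trans ?_ (le_ocsCompetitiveRatio d k hd (by omega))
  have h3e : 0 < 3 * Real.exp 1 := by positivity
  rw [one_div, Real.inv_rpow h3e.le]
  exact sub_le_sub_left (inv_anti₀ (Real.rpow_pos_of_pos h3e _)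
    (rpow_le_optimalCandidateFun d hd hd' k hk)) 1
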